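/- Setting. Let $\mathcal G=(\mathcal V,\mathcal E)$ be a finite directed graph, where $(i,j)\in\mathcal E$ denotes an edge from $j$ to $i$, and let $\mathcal N_i^-=\{j\neq i : (i,j)\in\mathcal E\}$. Assume that $\mathcal G$ is strongly connected (any two distinct nodes are joined by a directed path). Let $\mathcal P=[p_{ij}]$ be a real matrix indexed by $\mathcal V$ with $p_{ij}=0$ whenever $i\ne j$ and $(i,j)\notin\mathcal E$, such that * $\mathcal P$ is column-stochastic: $p_{ij}\ge 0$ and $\sum_i p_{ij}=1$ for every $j$; * $\mathcal P$ is primitive: it is nonnegative, irreducible (for all $i,j$ there is $t\ge1$ with $[\mathcal P^t]_{ij}>0$), and has only one (complex) eigenvalue of maximum modulus. Let $\mathcal D\ge 1$ be an integer that is an upper bound on the diameter of $\mathcal G$ (the greatest length of a shortest directed path between two nodes), and let $u_i^0$, $i\in\mathcal V$, be arbitrary vectors of a real normed space (for instance $\mathbb R^p$ with any norm). Finite-time $\varepsilon$-consensus protocol. Initialize $v_i^0=1$, $w_i^0=u_i^0$, $R_i^0=0$, $m=1$. For $k=0,1,2,\dots$ every agent $i\in\mathcal V$ computes $$u_i^{k+1}=p_{ii}u_i^k+\sum_{j\in\mathcal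 N_i^-}p_{ij}u_j^k,\qquad v_i^{k+1}=p_{ii}v_i^k+\sum_{j\in\mathcal N_i^-}p_{ij}v_j^k,\qquad w_i^{k+1}=\frac1{v_i^{k+1}}u_i^{k+1},$$ $$R_i^{k+1}=\max_{j\in\mathcal N_i^-}\bigl\{\|w_i^{k+1}-w_j^k\|+R_j^k\bigr\}$$ (the maximum being $0$ if there is only one agent, so that $\mathcal N_i^-=\emptyset$). If $k=m\mathcal D-1$, then agent $i$ sets $\widehat R_i^{m-1}=R_i^{k+1}$ and tests whether $\widehat R_i^{m-1}<\varepsilon$; if so, agent $i$ terminates (detects $\varepsilon$-consensus), and otherwise it goes on; in either case $R_i^{k+1}$ is reset to $0$ and $m$ is increased by $1$. An agent that has terminated keeps exchanging values with its neighbours by the same rules, so that all sequences are defined for all $k$ and $m$. Proposition 3.1. Under these assumptions $v_i^k>0$ for all $k\ge 0$ and $i\in\mathcal V$ (so the protocol is well defined), and for every $\varepsilon>0$ the protocol terminates after finitely many iterations at every agent: for each $i\in\mathcal V$ there is an iteration $k$ at which agent $i$ terminates, that is, at which its test succeeds for the first time. Moreover, for each $i\in\mathcal V$ all tests of agent $i$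 from some iteration on succeed, that is, $\widehat R_i^m<\varepsilon$ for all sufficiently large $m$. -/

import Mathlib

namespace EpsConsensus

/-! ### Directed graphs: `G.Adj j i` is an edge from `j` to `i`, written `(i, j) ∈ E`. -/

/-- Any two distinct nodes are joined by a directed path. -/
def StronglyConnected {V : Type*} (G : Digraph V) : Prop :=
  ∀ i j : V, i ≠ j → Relation.TransGen G.Adj i j

/-- There is a directed walk from `i` to `j` with exactly `n` edges. -/
def HasWalk {V : Type*} (G : Digraph V) : ℕ → V → V → Prop
  | 0, i, j => i = j
  | n + 1, i, j => ∃ l, G.Adj i l ∧ HasWalk G n l j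

/-- Length of a shortest directed path from `i` to `j` (`⊤` if there is none). -/
noncomputable def dist {V : Type*} (G : Digraph V) (i j : V) : ℕ∞ :=
  ⨅ (n : ℕ) (_ : HasWalk G n i j), (n : ℕ∞)

/-- Diameter: the greatest length of a shortest directed path between two nodes. -/
noncomputable def diameter {V : Type*} (G : Digraph V) : ℕ∞ :=
  ⨆ (i : V) (j : V), dist G i j

open Classical in
/-- The in-neighbours of `i`, not including `i` itself. -/
noncomputable def inNbrs {V : Type*} [Fintype V] (G : Digraph V) (i : V) : Finset V :=
  {j | j ≠ i ∧ G.Adj j i}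

/-! ### Weight matrices -/

/-- Irreducible: every entry is positive in some power of the matrix. -/
def IrreducibleMatrix {V : Type*} [Fintype V] [DecidableEq V] (M : Matrix V V ℝ) : Prop :=
  ∀ i j, ∃ t : ℕ, 0 < t ∧ 0 < (M ^ t) i j

/-- `z` is a (complex) eigenvalue of the real matrix `M`. -/
def IsComplexEigenvalue {V : Type*} [Fintype V] [DecidableEq V]
    (M : Matrix V V ℝ) (z : ℂ) : Prop :=
  Module.End.HasEigenvalue (Matrix.toLin' (M.map (algebraMap ℝ ℂ))) z

/-- Primitive: nonnegative, irreducible, with only one eigenvalue of maximum modulus. -/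
structure PrimitiveMatrix {V : Type*} [Fintype V] [DecidableEq V] (M : Matrix V V ℝ) : Prop where
  nonneg : ∀ i j, 0 ≤ M i j
  irreducible : IrreducibleMatrix M
  unique_max : ∃! z : ℂ, IsComplexEigenvalue M z ∧ ∀ y : ℂ, IsComplexEigenvalue M y → ‖y‖ ≤ ‖z‖

/-- `P` is a weight matrix on `G`: `P i j` is the weight of the edge from `j` to `i`, so it
vanishes off the edges. The diagonal entries are the weights that agents give to themselves. -/
def IsWeightMatrix {V : Type*} (G : Digraph V) (P : Matrix V V ℝ) : Prop :=
  ∀ i j, i ≠ j → ¬ G.Adj j i → P i j = 0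

/-! ### The finite-time `ε`-consensus protocol -/

/-- The variables `u, v, w, R, m` held by one agent. -/
structure AgentState (E : Type*) where
  u : E
  v : ℝ
  w : E
  R : ℝ
  m : ℕ

/-- Initialization: `u = w = u⁰`, `v = 1`, `R = 0`, `m = 1`. -/
def initState {E : Type*} (x : E) : AgentState E where
  u := x
  v := 1
  w := x
  R := 0
  m := 1

section Step

variable {V : Type*} [Fintype V] {E : Type*} [NormedAddCommGroup E] [NormedSpace ℝ E]

/-- `u_i^{k+1} = p_ii u_i^k + ∑_{j ∈ N_i^-} p_ij u_j^k` -/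
noncomputable def nextU (G : Digraph V) (P : Matrix V V ℝ) (S : V → AgentState E) (i : V) : E :=
  P i i • (S i).u + ∑ j ∈ inNbrs G i, P i j • (S j).u

/-- `v_i^{k+1} = p_ii v_i^k + ∑_{j ∈ N_i^-} p_ij v_j^k` -/
noncomputable def nextV (G : Digraph V) (P : Matrix V V ℝ) (S : V → AgentState E) (i : V) : ℝ :=
  P i i * (S i).v + ∑ j ∈ inNbrs G i, P i j * (S j).v

/-- `w_i^{k+1} = (1 / v_i^{k+1}) u_i^{k+1}` -/
noncomputable def nextW (G : Digraph V) (P : Matrix V V ℝ) (S : V → AgentState E) (i : V) : E :=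
  (1 / nextV G P S i) • nextU G P S i

open Classical in
/-- `max_{j ∈ N_i^-} { ‖w_i^{k+1} - w_j^k‖ + R_j^k }`, the radius before it is tested and
possibly reset. The maximum is `0` if there are no in-neighbours (a single agent). -/
noncomputable def nextR (G : Digraph V) (P : Matrix V V ℝ) (S : V → AgentState E) (i : V) : ℝ :=
  if h : (inNbrs G i).Nonempty then
    (inNbrs G i).sup' h fun j => ‖nextW G P S i - (S j).w‖ + (S j).R
  else 0

/-- Iteration `k` of the loop at all agents. At `k = m D - 1` the radius is reset and `m` is
incremented. An agent that has passed its own termination test keeps exchanging values with its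
neighbours, so that the sequences of the protocol are defined for all `k`. -/
noncomputable def step (G : Digraph V) (P : Matrix V V ℝ) (D k : ℕ) (S : V → AgentState E) :
    V → AgentState E := fun i =>
  { u := nextU G P S i
    v := nextV G P S i
    w := nextW G P S i
    R := if k + 1 = (S i).m * D then 0 else nextR G P S i
    m := if k + 1 = (S i).m * D then (S i).m + 1 else (S i).m }

/-- The states of all agents at the start of iteration `k`. -/
noncomputable def run (G : Digraph V) (P : Matrix V V ℝ) (D : ℕ) (u₀ : V → E) :
    ℕ → V → AgentState E
  | 0 => fun i => initState (u₀ i)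
  | k + 1 => step G P D k (run G P D u₀ k)

/-- Agent `i` performs its termination test in iteration `k`, that is, `k = m D - 1`. -/
def TestsAt (G : Digraph V) (P : Matrix V V ℝ) (D : ℕ) (u₀ : V → E) (i : V) (k : ℕ) : Prop :=
  k + 1 = (run G P D u₀ k i).m * D

/-- The radius computed by agent `i` in iteration `k`, before a reset. If `k = m D - 1`, this is
the tested radius `R̂_i^{m-1}`. -/
noncomputable def testedRadius (G : Digraph V) (P : Matrix V V ℝ) (D : ℕ) (u₀ : V → E)
    (i : V) (k : ℕ) : ℝ :=
  nextR G P (run G P D u₀ k) i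

/-- Agent `i` executes `break` in iteration `k`: its test succeeds there for the first time. -/
def TerminatesAt (G : Digraph V) (P : Matrix V V ℝ) (D : ℕ) (u₀ : V → E) (ε : ℝ)
    (i : V) (k : ℕ) : Prop :=
  (TestsAt G P D u₀ i k ∧ testedRadius G P D u₀ i k < ε) ∧
    ∀ l < k, TestsAt G P D u₀ i l → ε ≤ testedRadius G P D u₀ i l

end Step

end EpsConsensus

/-! The matrix `P ^ k` converges to the matrix whose columns all equal the positive stationary
vector `π` (`exists_tendsto_pow`). Hence `u_i` tends to `π i` times the sum of the initial values
and `v_i` to `π i` times the number of agents, so every ratio `w_i` tends to the same average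
(`tendsto_run_w`). Differences between consecutive `w` are then eventually small, and since the
radius is reset every `D` iterations it accumulates at most `D` of them (`run_R_le`).

For the matrix limit, let `B` have all columns equal to `π`. Positive powers satisfy `(P - B) ^ k =
P ^ k - B`, so it suffices that all eigenvalues of `P - B` lie in the open unit disc; primitivity
and irreducibility rule out the others. -/

namespace EpsConsensus

/-! ### Perron–Frobenius theory: convergence of powers -/

section Perron

open Filter Topology Matrix

/-- In a complex Banach algebra, the powers of an element whose spectrum lies in the open unit disc
tend to zero. -/
theorem tendsto_pow_zero_of_spectrum {A : Type*} [NormedRing A] [NormedAlgebra ℂ A]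
    [CompleteSpace A] {a : A} (h : ∀ z ∈ spectrum ℂ a, ‖z‖ < 1) :
    Tendsto (fun k : ℕ => a ^ k) atTop (𝓝 0) := by
  rcases subsingleton_or_nontrivial A with hA | hA
  · exact tendsto_const_nhds.congr fun k => Subsingleton.elim _ _
  have hρ : spectralRadius ℂ a < ((1 : NNReal) : ENNReal) :=
    spectrum.spectralRadius_lt_of_forall_lt a fun z hz => by
      rw [← NNReal.coe_lt_coe]; simpa using h z hz
  -- Gelfand's formula: for `r` strictly between the spectral radius and 1, eventually `‖a ^ k‖ ≤ r
  -- ^ k`.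
  obtain ⟨r, hr₁, hr₂⟩ := ENNReal.lt_iff_exists_nnreal_btwn.1 hρ
  have hr : r < 1 := by exact_mod_cast hr₂
  have hev := (spectrum.pow_nnnorm_pow_one_div_tendsto_nhds_spectralRadius a).eventually_lt_const hr₁
  refine squeeze_zero_norm' ?_ (tendsto_pow_atTop_nhds_zero_of_lt_one r.2 (by exact_mod_cast hr))
  filter_upwards [hev, eventually_gt_atTop 0] with k hk hk0
  have hk' : (0 : ℝ) < k := by exact_mod_cast hk0
  have h2 : (‖a ^ k‖₊ : ENNReal) ≤ (r : ENNReal) ^ (k : ℝ) := by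
    have := ENNReal.rpow_le_rpow hk.le hk'.le
    rwa [← ENNReal.rpow_mul, one_div, inv_mul_cancel₀ hk'.ne', ENNReal.rpow_one] at this
  rw [ENNReal.rpow_natCast] at h2
  exact_mod_cast h2

open scoped Matrix.Norms.Operator in
/-- The powers of a real matrix all of whose complex eigenvalues lie in the open unit disc tend to
zero. -/
theorem tendsto_pow_apply_zero {V : Type*} [Fintype V] [DecidableEq V] {Q : Matrix V V ℝ}
    (h : ∀ z, IsComplexEigenvalue Q z → ‖z‖ < 1) (i j : V) :
    Tendsto (fun k : ℕ => (Q ^ k) i j) atTop (𝓝 0) := by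
  have h1 : Tendsto (fun k : ℕ => (Q.map (algebraMap ℝ ℂ)) ^ k) atTop (𝓝 0) := by
    refine tendsto_pow_zero_of_spectrum fun z hz => h z ?_
    rw [← Matrix.spectrum_toLin', ← Module.End.hasEigenvalue_iff_mem_spectrum] at hz
    exact hz
  have h2 : Tendsto (fun k : ℕ => ((Q.map (algebraMap ℝ ℂ)) ^ k) i j) atTop (𝓝 0) :=
    ((continuous_apply_apply i j).tendsto _).comp h1
  have h3 := (Complex.continuous_re.tendsto _).comp h2
  refine Tendsto.congr (fun k => ?_) h3
  have h4 := congrFun (congrFun (Matrix.map_pow Q (algebraMap ℝ ℂ) k) i) j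
  exact (congrArg Complex.re h4).symm

variable {V : Type*} [Fintype V] [DecidableEq V] {P : Matrix V V ℝ}

theorem isComplexEigenvalue_iff {M : Matrix V V ℝ} {z : ℂ} :
    IsComplexEigenvalue M z ↔ ∃ x : V → ℂ, x ≠ 0 ∧ ∀ i, ∑ j, (M i j : ℂ) * x j = z * x i := by
  constructor
  · intro h
    obtain ⟨x, hx⟩ := h.exists_hasEigenvector
    refine ⟨x, hx.2, fun i => ?_⟩
    have := congrFun hx.apply_eq_smul i
    simpa [Matrix.mulVec, dotProduct] using this
  · rintro ⟨x, hx0, hx⟩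
    refine Module.End.hasEigenvalue_of_hasEigenvector (x := x)
      ⟨Module.End.mem_eigenspace_iff.2 ?_, hx0⟩
    ext i
    simpa [Matrix.mulVec, dotProduct] using hx i

/-- A column-stochastic matrix does not increase the ℓ¹ norm of an eigenvector. -/
theorem norm_le_one_of_isComplexEigenvalue (hcol : P ∈ Matrix.colStochastic ℝ V) {z : ℂ}
    (hz : IsComplexEigenvalue P z) : ‖z‖ ≤ 1 := by
  obtain ⟨x, hx0, hx⟩ := isComplexEigenvalue_iff.1 hz
  obtain ⟨hnn, hs⟩ := mem_colStochastic_iff_sum.1 hcol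
  have hpos : 0 < ∑ i, ‖x i‖ := by
    obtain ⟨i, hi⟩ := Function.ne_iff.1 hx0
    exact Finset.sum_pos' (fun _ _ => norm_nonneg _) ⟨i, Finset.mem_univ _, norm_pos_iff.2 hi⟩
  have : ‖z‖ * ∑ i, ‖x i‖ ≤ 1 * ∑ i, ‖x i‖ := by
    have hsum := sum_mulVec_of_mem_colStochastic (x := fun j => ‖x j‖) hcol
    rw [one_mul, Finset.mul_sum]
    refine le_of_le_of_eq ?_ hsum
    refine Finset.sum_le_sum fun i _ => ?_
    change ‖z‖ * ‖x i‖ ≤ ∑ j, P i j * ‖x j‖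
    rw [← norm_mul, ← hx i]
    refine (norm_sum_le _ _).trans (Finset.sum_le_sum fun j _ => ?_)
    rw [norm_mul, Complex.norm_real, Real.norm_of_nonneg (hnn i j)]
  exact le_of_mul_le_mul_right this hpos

/-- The triangle inequality gives `|x| ≤ P *ᵥ |x|` entrywise; both sides have the same total, so
equality holds in each entry. -/
theorem mulVec_abs_of_mulVec_eq (hcol : P ∈ Matrix.colStochastic ℝ V) {x : V → ℝ}
    (hx : P *ᵥ x = x) : P *ᵥ |x| = |x| := by
  obtain ⟨hnn, hs⟩ := mem_colStochastic_iff_sum.1 hcol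
  have hle : ∀ i ∈ Finset.univ, |x| i ≤ (P *ᵥ |x|) i := fun i _ => by
    have hi : |x| i = |∑ j, P i j * x j| := by
      rw [Pi.abs_apply]; exact congrArg _ (congrFun hx i).symm
    rw [hi]
    refine (Finset.abs_sum_le_sum_abs _ _).trans (Finset.sum_le_sum fun j _ => ?_)
    rw [abs_mul, abs_of_nonneg (hnn i j), Pi.abs_apply]
  have := (Finset.sum_eq_sum_iff_of_le hle).1 (sum_mulVec_of_mem_colStochastic hcol).symm
  ext i
  exact (this i (Finset.mem_univ i)).symm

theorem pow_mulVec_eq {x : V → ℝ} (hx : P *ᵥ x = x) (t : ℕ) : (P ^ t) *ᵥ x = x := by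
  induction t with
  | zero => simp
  | succ t ih => rw [pow_succ, ← Matrix.mulVec_mulVec, hx, ih]

theorem pow_apply_nonneg (hnn : ∀ i j, 0 ≤ P i j) (t : ℕ) (i j : V) : 0 ≤ (P ^ t) i j := by
  induction t generalizing i j with
  | zero => simp only [pow_zero, Matrix.one_apply]; split_ifs <;> norm_num
  | succ t ih =>
    rw [pow_succ, Matrix.mul_apply]
    exact Finset.sum_nonneg fun l _ => mul_nonneg (ih i l) (hnn l j)

/-- A nonnegative nonzero fixed vector of an irreducible nonnegative matrix is positive. -/
theorem pos_of_mulVec_eq (hnn : ∀ i j, 0 ≤ P i j) (hirr : IrreducibleMatrix P) {x : V → ℝ}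
    (hx : P *ᵥ x = x) (hx0 : 0 ≤ x) (hne : x ≠ 0) (i : V) : 0 < x i := by
  obtain ⟨j, hj⟩ := Function.ne_iff.1 hne
  obtain ⟨t, -, ht⟩ := hirr i j
  rw [← pow_mulVec_eq hx t]
  refine Finset.sum_pos' (fun l _ => mul_nonneg (pow_apply_nonneg hnn t i l) (hx0 l))
    ⟨j, Finset.mem_univ _, mul_pos ht ((hx0 j).lt_of_ne' hj)⟩

/-- The all-ones row vector is fixed from the left, so `P - 1` is singular. Normalize the absolute
value of a kernel vector. -/
theorem exists_stationary [Nonempty V] (hcol : P ∈ Matrix.colStochastic ℝ V)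
    (hirr : IrreducibleMatrix P) :
    ∃ π : V → ℝ, P *ᵥ π = π ∧ (∀ i, 0 < π i) ∧ ∑ i, π i = 1 := by
  obtain ⟨hnn, hs⟩ := mem_colStochastic_iff_sum.1 hcol
  have hdet : (P - 1).det = 0 := by
    refine Matrix.exists_vecMul_eq_zero_iff.1 ⟨1, one_ne_zero, ?_⟩
    rw [Matrix.vecMul_sub, one_vecMul_of_mem_colStochastic hcol, Matrix.vecMul_one, sub_self]
  obtain ⟨x, hx0, hx⟩ := Matrix.exists_mulVec_eq_zero_iff.2 hdet
  rw [Matrix.sub_mulVec, Matrix.one_mulVec, sub_eq_zero] at hx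
  have hy := mulVec_abs_of_mulVec_eq hcol hx
  have hpos := pos_of_mulVec_eq hnn hirr hy (abs_nonneg x) (by simpa using hx0)
  have hsum : 0 < ∑ i, |x| i := Finset.sum_pos (fun i _ => hpos i) Finset.univ_nonempty
  refine ⟨(∑ i, |x| i)⁻¹ • |x|, by rw [Matrix.mulVec_smul, hy], fun i => ?_, ?_⟩
  · exact mul_pos (inv_pos.2 hsum) (hpos i)
  · simp only [Pi.smul_apply, smul_eq_mul, ← Finset.mul_sum]
    exact inv_mul_cancel₀ hsum.ne'

/-- A fixed vector of an irreducible column-stochastic matrix whose entries sum to zero vanishes. -/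
theorem eq_zero_of_mulVec_eq_of_sum_eq_zero (hcol : P ∈ Matrix.colStochastic ℝ V)
    (hirr : IrreducibleMatrix P) {x : V → ℝ} (hx : P *ᵥ x = x) (hsum : ∑ i, x i = 0) :
    x = 0 := by
  obtain ⟨hnn, -⟩ := mem_colStochastic_iff_sum.1 hcol
  have hy := mulVec_abs_of_mulVec_eq hcol hx
  -- The fixed vector `|x| + x` is either zero or positive everywhere, so `x` has constant sign; its
  -- sum being zero, it vanishes.
  by_cases h1 : |x| + x = 0
  · have : ∀ i ∈ Finset.univ, x i ≤ 0 := fun i _ => by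
      have := congrFun h1 i
      simp only [Pi.add_apply, Pi.abs_apply, Pi.zero_apply] at this
      linarith [abs_nonneg (x i)]
    ext i
    exact (Finset.sum_eq_zero_iff_of_nonpos this).1 hsum i (Finset.mem_univ i)
  · have hpos := pos_of_mulVec_eq hnn hirr (x := |x| + x) (by rw [Matrix.mulVec_add, hx, hy])
      (fun i => by
        simp only [Pi.add_apply, Pi.abs_apply, Pi.zero_apply]
        linarith [neg_abs_le (x i)]) h1
    have : ∀ i ∈ Finset.univ, 0 ≤ x i := fun i _ => by
      by_contra! hneg
      have := hpos i
      simp only [Pi.add_apply, Pi.abs_apply, abs_of_neg hneg] at this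
      linarith
    ext i
    exact (Finset.sum_eq_zero_iff_of_nonneg this).1 hsum i (Finset.mem_univ i)

/-- The powers of a primitive column-stochastic matrix converge to a positive matrix with equal
columns. -/
theorem exists_tendsto_pow [Nonempty V] (hcol : P ∈ Matrix.colStochastic ℝ V)
    (hprim : PrimitiveMatrix P) :
    ∃ π : V → ℝ, (∀ i, 0 < π i) ∧
      ∀ i j, Tendsto (fun k : ℕ => (P ^ k) i j) atTop (𝓝 (π i)) := by
  obtain ⟨π, hfix, hpos, hπ⟩ := exists_stationary hcol hprim.irreducible
  obtain ⟨hnn, hs⟩ := mem_colStochastic_iff_sum.1 hcol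
  refine ⟨π, hpos, fun i j => ?_⟩
  set B : Matrix V V ℝ := Matrix.of fun i _ => π i with hB
  have hPB : P * B = B := by
    ext a b
    exact congrFun hfix a
  have hBP : B * P = B := by
    ext a b
    simp [hB, Matrix.mul_apply, ← Finset.mul_sum, hs]
  have hBB : B * B = B := by
    ext a b
    simp [hB, Matrix.mul_apply, ← Finset.mul_sum, hπ]
  -- The exponent is shifted because the second identity fails at exponent 0.
  have hpow : ∀ k : ℕ, P ^ (k + 1) * B = B ∧ (P - B) ^ (k + 1) = P ^ (k + 1) - B := by
    intro k
    induction k with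
    | zero => simp [hPB]
    | succ k ih =>
      refine ⟨by rw [pow_succ, mul_assoc, hPB, ih.1], ?_⟩
      rw [pow_succ, ih.2, mul_sub, sub_mul, sub_mul, hBP, hBB, ih.1, ← pow_succ]
      abel
  have hone : IsComplexEigenvalue P 1 := by
    refine isComplexEigenvalue_iff.2 ⟨fun i => (π i : ℂ), fun h => ?_, fun a => ?_⟩
    · exact (hpos i).ne' (by simpa using congrFun h i)
    · rw [one_mul]
      have ha : ∑ b, P a b * π b = π a := congrFun hfix a
      change ∑ b, (P a b : ℂ) * (π b : ℂ) = (π a : ℂ)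
      exact_mod_cast ha
  have hQ : ∀ z, IsComplexEigenvalue (P - B) z → ‖z‖ < 1 := by
    intro z hz
    by_contra! hz1
    have hz0 : z ≠ 0 := fun h => by norm_num [h] at hz1
    obtain ⟨x, hx0, hx⟩ := isComplexEigenvalue_iff.1 hz
    -- The columns of `P - B` sum to zero and `z ≠ 0`. Therefore `B` kills `x`, and `x` is an
    -- eigenvector of `P` itself.
    have hxsum : ∑ a, x a = 0 := by
      have h1 : z * ∑ a, x a = 0 := by
        rw [Finset.mul_sum]
        simp_rw [← hx]
        rw [Finset.sum_comm]
        refine Finset.sum_eq_zero fun b _ => ?_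
        rw [← Finset.sum_mul]
        have : ∑ a, (P - B) a b = 0 := by simp [hB, hs, hπ]
        rw [← Complex.ofReal_sum, this]
        simp
      exact (mul_eq_zero.1 h1).resolve_left hz0
    have hPx : ∀ a, ∑ b, (P a b : ℂ) * x b = z * x a := fun a => by
      rw [← hx a]
      simp [hB, sub_mul, ← Finset.mul_sum, hxsum]
    have hzP : IsComplexEigenvalue P z := isComplexEigenvalue_iff.2 ⟨x, hx0, hPx⟩
    -- Both `z` and 1 are eigenvalues of `P` of maximum modulus.
    have hz1 : z = 1 := hprim.unique_max.unique
      ⟨hzP, fun y hy => (norm_le_one_of_isComplexEigenvalue hcol hy).trans hz1⟩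
      ⟨hone, fun y hy => by simpa using norm_le_one_of_isComplexEigenvalue hcol hy⟩
    refine hx0 (funext fun a => Complex.ext ?_ ?_)
    · refine congrFun (eq_zero_of_mulVec_eq_of_sum_eq_zero hcol hprim.irreducible
        (x := fun b => (x b).re) (funext fun c => ?_) ?_) a
      · simpa [hz1, Matrix.mulVec, dotProduct] using congrArg Complex.re (hPx c)
      · simpa using congrArg Complex.re hxsum
    · refine congrFun (eq_zero_of_mulVec_eq_of_sum_eq_zero hcol hprim.irreducible
        (x := fun b => (x b).im) (funext fun c => ?_) ?_) a
      · simpa [hz1, Matrix.mulVec, dotProduct] using congrArg Complex.im (hPx c)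
      · simpa using congrArg Complex.im hxsum
  have hlim := (tendsto_add_atTop_iff_nat 1).2 (tendsto_pow_apply_zero hQ i j)
  refine (tendsto_add_atTop_iff_nat 1).1 ?_
  have h2 := hlim.add_const (π i)
  rw [zero_add] at h2
  refine h2.congr fun k => ?_
  rw [(hpow k).2]
  simp [hB]

end Perron

/-! ### The protocol: closed forms, limits and radii -/

section Protocol

open Filter Topology

variable {V : Type*} [Fintype V]
  {E : Type*} [NormedAddCommGroup E] [NormedSpace ℝ E]
  {G : Digraph V} {P : Matrix V V ℝ}

theorem sum_inNbrs_of_isWeightMatrix (hGP : IsWeightMatrix G P) {F : Type*} [AddCommGroup F]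
    [Module ℝ F] (f : V → F) (i : V) :
    P i i • f i + ∑ j ∈ inNbrs G i, P i j • f j = ∑ j, P i j • f j := by
  classical
  rw [← Finset.add_sum_erase Finset.univ _ (Finset.mem_univ i)]
  congr 1
  refine Finset.sum_subset (fun j hj => ?_) fun j hj hj' => ?_
  · simp only [inNbrs, Finset.mem_filter] at hj
    simpa using hj.2.1
  · have hji : j ≠ i := by simpa using hj
    rw [hGP i j hji.symm fun h => hj' (by simp [inNbrs, hji, h]), zero_smul]

theorem run_u [DecidableEq V] (hGP : IsWeightMatrix G P) (D : ℕ) (u₀ : V → E) (k : ℕ) (i : V) :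
    (run G P D u₀ k i).u = ∑ j, (P ^ k) i j • u₀ j := by
  induction k generalizing i with
  | zero => simp [run, initState, Matrix.one_apply, ite_smul]
  | succ k ih =>
    change nextU G P (run G P D u₀ k) i = _
    rw [nextU, sum_inNbrs_of_isWeightMatrix hGP (fun j => (run G P D u₀ k j).u), pow_succ']
    simp_rw [ih, Matrix.mul_apply, Finset.sum_smul, Finset.smul_sum, mul_smul]
    exact Finset.sum_comm

theorem run_v [DecidableEq V] (hGP : IsWeightMatrix G P) (D : ℕ) (u₀ : V → E) (k : ℕ) (i : V) :
    (run G P D u₀ k i).v = ∑ j, (P ^ k) i j := by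
  induction k generalizing i with
  | zero => simp [run, initState, Matrix.one_apply]
  | succ k ih =>
    change nextV G P (run G P D u₀ k) i = _
    have := sum_inNbrs_of_isWeightMatrix hGP (fun j => (run G P D u₀ k j).v) i
    simp only [smul_eq_mul] at this
    rw [nextV, this, pow_succ']
    simp_rw [ih, Matrix.mul_apply, Finset.mul_sum]
    exact Finset.sum_comm

theorem run_w (D : ℕ) (u₀ : V → E) (k : ℕ) (i : V) :
    (run G P D u₀ k i).w = (1 / (run G P D u₀ k i).v) • (run G P D u₀ k i).u := by
  cases k with
  | zero => simp [run, initState]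
  | succ k => rfl

theorem run_m (D : ℕ) (u₀ : V → E) (k : ℕ) (i : V) :
    (run G P D u₀ k i).m = k / D + 1 := by
  induction k with
  | zero => simp [run, initState]
  | succ k ih =>
    change (if k + 1 = (run G P D u₀ k i).m * D then (run G P D u₀ k i).m + 1
      else (run G P D u₀ k i).m) = _
    rw [ih, Nat.succ_div]
    -- Resets occur exactly when `D` divides `k + 1`.
    have hdvd : k + 1 = (k / D + 1) * D ↔ D ∣ k + 1 := by
      refine ⟨fun h => ⟨k / D + 1, by rw [mul_comm]; exact h⟩, fun ⟨c, hc⟩ => ?_⟩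
      have h1 := Nat.succ_div_of_dvd ⟨c, hc⟩
      rw [← h1, Nat.div_mul_cancel ⟨c, hc⟩]
    simp only [hdvd]
    split_ifs <;> rfl

theorem testsAt_iff (D : ℕ) (u₀ : V → E) (i : V) (k : ℕ) :
    TestsAt G P D u₀ i k ↔ k + 1 = (k / D + 1) * D := by
  rw [TestsAt, run_m]

theorem testsAt_of_mul {D : ℕ} (hD : 1 ≤ D) (u₀ : V → E) (i : V) (q : ℕ) :
    TestsAt G P D u₀ i (q * D + (D - 1)) := by
  rw [testsAt_iff, add_comm (q * D), Nat.add_mul_div_right _ _ hD,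
    Nat.div_eq_of_lt (by omega : D - 1 < D), add_mul, add_mul]
  omega

theorem run_v_pos [DecidableEq V] (hnn : ∀ i j, 0 ≤ P i j) (hirr : IrreducibleMatrix P)
    (hGP : IsWeightMatrix G P) (D : ℕ) (u₀ : V → E) (k : ℕ) (i : V) :
    0 < (run G P D u₀ k i).v := by
  induction k generalizing i with
  | zero => simp [run, initState]
  | succ k ih =>
    change 0 < nextV G P (run G P D u₀ k) i
    have h := sum_inNbrs_of_isWeightMatrix hGP (fun j => (run G P D u₀ k j).v) i
    simp only [smul_eq_mul] at h
    rw [nextV, h]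
    -- A zero row of `P` would stay zero in every positive power, against irreducibility.
    have hrow : ∃ j, P i j ≠ 0 := by
      by_contra! h0
      obtain ⟨t, ht, hpos⟩ := hirr i i
      obtain ⟨t, rfl⟩ := Nat.exists_eq_succ_of_ne_zero ht.ne'
      simp [pow_succ', Matrix.mul_apply, h0] at hpos
    obtain ⟨j, hj⟩ := hrow
    exact Finset.sum_pos' (fun l _ => mul_nonneg (hnn i l) (ih l).le)
      ⟨j, Finset.mem_univ _, mul_pos ((hnn i j).lt_of_ne' hj) (ih j)⟩

/-- The ratios `w_i^k` converge to the average of the initial values. -/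
theorem tendsto_run_w [DecidableEq V] (hcol : P ∈ Matrix.colStochastic ℝ V) (hprim : PrimitiveMatrix P)
    (hGP : IsWeightMatrix G P) (D : ℕ) (u₀ : V → E) (i : V) :
    Tendsto (fun k => (run G P D u₀ k i).w) atTop
      (𝓝 ((1 / (Fintype.card V : ℝ)) • ∑ j, u₀ j)) := by
  have : Nonempty V := ⟨i⟩
  obtain ⟨π, hpos, hlim⟩ := exists_tendsto_pow hcol hprim
  have hcard : (Fintype.card V : ℝ) ≠ 0 := by exact_mod_cast Fintype.card_ne_zero
  have hu : Tendsto (fun k => (run G P D u₀ k i).u) atTop (𝓝 (∑ j, π i • u₀ j)) := by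
    simp_rw [run_u hGP]
    exact tendsto_finsetSum _ fun j _ => (hlim i j).smul_const _
  have hv : Tendsto (fun k => (run G P D u₀ k i).v) atTop (𝓝 (Fintype.card V * π i)) := by
    simp_rw [run_v hGP]
    have := tendsto_finsetSum Finset.univ fun j _ => hlim i j
    simpa using this
  have hw := ((tendsto_const_nhds (x := (1 : ℝ))).div hv (mul_ne_zero hcard (hpos i).ne')).smul hu
  convert hw.congr fun k => (run_w D u₀ k i).symm using 2
  rw [← Finset.smul_sum, smul_smul]
  congr 1
  have := (hpos i).ne'
  field_simp

theorem nextR_le {S : V → AgentState E} {i : V} {δ c : ℝ} (hδ : 0 ≤ δ) (hc : 0 ≤ c)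
    (hw : ∀ j, ‖nextW G P S i - (S j).w‖ ≤ δ) (hR : ∀ j, (S j).R ≤ c) :
    nextR G P S i ≤ δ + c := by
  rw [nextR]
  split_ifs with h
  · exact Finset.sup'_le _ _ fun j _ => add_le_add (hw j) (hR j)
  · exact add_nonneg hδ hc

/-- Once all one-step differences are at most `δ`, the radius is at most `δ` times the number of
iterations since the last reset. -/
theorem run_R_le {D : ℕ} (hD : 1 ≤ D) {u₀ : V → E} {δ : ℝ} (hδ : 0 ≤ δ) {q : ℕ}
    (hw : ∀ k ≥ q * D, ∀ i j, ‖(run G P D u₀ (k + 1) i).w - (run G P D u₀ k j).w‖ ≤ δ)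
    {p r : ℕ} (hp : q ≤ p) (hr : r < D) (i : V) :
    (run G P D u₀ (p * D + r) i).R ≤ r * δ := by
  induction r generalizing i with
  | zero =>
    -- A block starts with radius 0: by initialization if `p = 0`, otherwise by the reset in the
    -- preceding iteration.
    rcases Nat.eq_zero_or_pos p with rfl | h0
    · simp [run, initState]
    · obtain ⟨p, rfl⟩ := Nat.exists_eq_succ_of_ne_zero h0.ne'
      have hk : (p + 1) * D + 0 = (p * D + (D - 1)) + 1 := by rw [add_mul]; omega
      have ht : TestsAt G P D u₀ i (p * D + (D - 1)) := testsAt_of_mul hD u₀ i p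
      rw [Nat.succ_eq_add_one, hk]
      change (if _ + 1 = (run G P D u₀ (p * D + (D - 1)) i).m * D then (0 : ℝ) else _) ≤ _
      rw [if_pos (show _ = _ from ht)]
      simp
  | succ r ih =>
    have hqp : q * D ≤ p * D := Nat.mul_le_mul_right D hp
    have h := nextR_le (G := G) (P := P) (S := run G P D u₀ (p * D + r)) (i := i) hδ
      (by positivity : 0 ≤ (r : ℝ) * δ) (hw (p * D + r) (by omega) i)
      (fun j => ih (by omega) j)
    change (if _ then (0 : ℝ) else nextR G P (run G P D u₀ (p * D + r)) i) ≤ _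
    push_cast
    -- A reset only helps the bound, so there is no need to exclude one inside the block.
    split_ifs
    · positivity
    · linarith

/-- Every radius computed late enough is smaller than `ε`. -/
theorem eventually_testedRadius_lt [DecidableEq V] (hcol : P ∈ Matrix.colStochastic ℝ V)
    (hprim : PrimitiveMatrix P) (hGP : IsWeightMatrix G P) {D : ℕ} (hD : 1 ≤ D) (u₀ : V → E)
    {ε : ℝ} (hε : 0 < ε) (i : V) :
    ∀ᶠ k in atTop, testedRadius G P D u₀ i k < ε := by
  have hD' : (0 : ℝ) < D := by exact_mod_cast hD
  -- At most `D` increments of size `δ` add up to `ε / 2`, which leaves strict room below `ε`.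
  set δ := ε / (2 * D) with hδdef
  have hδ : 0 < δ := by positivity
  have hev : ∀ᶠ k in atTop, ∀ i j,
      ‖(run G P D u₀ (k + 1) i).w - (run G P D u₀ k j).w‖ ≤ δ := by
    refine eventually_all.2 fun a => eventually_all.2 fun b => ?_
    have h1 := ((tendsto_add_atTop_iff_nat 1).2
      (tendsto_run_w hcol hprim hGP D u₀ a)).sub (tendsto_run_w hcol hprim hGP D u₀ b)
    rw [sub_self] at h1
    have h2 := h1.norm
    rw [norm_zero] at h2
    exact h2.eventually_le_const hδ
  obtain ⟨q, hq⟩ := eventually_atTop.1 hev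
  -- Rounding the threshold `q` up to `q * D` makes it the start of a block, as `run_R_le` requires.
  refine eventually_atTop.2 ⟨q * D, fun k hk => ?_⟩
  have hw : ∀ k ≥ q * D, ∀ i j,
      ‖(run G P D u₀ (k + 1) i).w - (run G P D u₀ k j).w‖ ≤ δ :=
    fun k hk => hq k ((Nat.le_mul_of_pos_right q hD).trans hk)
  have hr := Nat.mod_lt k hD
  have hR : ∀ j, (run G P D u₀ k j).R ≤ (k % D : ℕ) * δ := fun j => by
    have := run_R_le hD hδ.le hw ((Nat.le_div_iff_mul_le hD).2 hk) hr j
    rwa [Nat.div_add_mod' k D] at this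
  have h := nextR_le (G := G) (P := P) (i := i) hδ.le (by positivity) (hw k hk i) hR
  have hle : ((k % D : ℕ) : ℝ) + 1 ≤ D := by exact_mod_cast hr
  calc testedRadius G P D u₀ i k ≤ δ + (k % D : ℕ) * δ := h
    _ = ((k % D : ℕ) + 1) * δ := by ring
    _ ≤ D * δ := by gcongr
    _ = ε / 2 := by rw [hδdef]; field_simp
    _ < ε := half_lt_self hε

end Protocol

end EpsConsensus

theorem proposition3p1 {V : Type*} [Fintype V] [DecidableEq V]
    {E : Type*} [NormedAddCommGroup E] [NormedSpace ℝ E]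
    (G : Digraph V) (hG : EpsConsensus.StronglyConnected G)
    (P : Matrix V V ℝ) (hGP : EpsConsensus.IsWeightMatrix G P)
    (hprim : EpsConsensus.PrimitiveMatrix P) (hcol : P ∈ Matrix.colStochastic ℝ V)
    (D : ℕ) (hD : 1 ≤ D) (hdiam : EpsConsensus.diameter G ≤ (D : ℕ∞))
    (u₀ : V → E) :
    -- the divisions `1 / v_i^k` are well defined
    (∀ (k : ℕ) (i : V), 0 < (EpsConsensus.run G P D u₀ k i).v) ∧
    ∀ ε : ℝ, 0 < ε → ∀ i : V,
      -- agent `i` executes `break` after finitely many iterations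
      (∃ k : ℕ, EpsConsensus.TerminatesAt G P D u₀ ε i k) ∧
      -- and all its later tests, in an execution that goes on, succeed from some iteration on
      (∃ K : ℕ, ∀ k ≥ K, EpsConsensus.TestsAt G P D u₀ i k →
        EpsConsensus.testedRadius G P D u₀ i k < ε) := by
  refine ⟨EpsConsensus.run_v_pos hprim.nonneg hprim.irreducible hGP D u₀, fun ε hε i => ?_⟩
  obtain ⟨K, hK⟩ := Filter.eventually_atTop.1
    (EpsConsensus.eventually_testedRadius_lt hcol hprim hGP hD u₀ hε i)
  refine ⟨?_, K, fun k hk _ => hK k hk⟩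
  classical
  have hex : ∃ k, EpsConsensus.TestsAt G P D u₀ i k ∧ EpsConsensus.testedRadius G P D u₀ i k < ε :=
    ⟨K * D + (D - 1), EpsConsensus.testsAt_of_mul hD u₀ i K,
      hK _ ((Nat.le_mul_of_pos_right K hD).trans (Nat.le_add_right _ _))⟩
  -- Termination means the first success, hence the least witness.
  exact ⟨Nat.find hex, Nat.find_spec hex,
    fun l hl ht => not_lt.1 fun h => Nat.find_min hex hl ⟨ht, h⟩⟩
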